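/- **Theorem (Cut elimination for $\mathbf{HE}$).** Formulas are built from propositional variables by $\neg$, $\to$, $\Box$, the conditional obligation $\bigcirc(B/A)$ and an auxiliary unary modality $\mathcal{B}et$. A sequent $\Gamma\Rightarrow\Delta$ is a pair of finite multisets of formulas; a hypersequent is a finite multiset of sequents (its components), written $\Gamma_1\Rightarrow\Delta_1\mid\dots\mid\Gamma_n\Rightarrow\Delta_n$. Write $\Gamma^{\Box}$ and $\Gamma^{O}$ for the sub-multisets of the formulas in $\Gamma$ of the form $\Box A$, respectively $\bigcirc(B/A)$, and $\Gamma^{b\downarrow}$ for the multiset of the $A$ with $\mathcal{B}et\,A$ in $\Gamma$. The calculus $\mathbf{HE}$ has the initial hypersequents $G\mid\Gamma,p\Rightarrow\Delta,p$ ($p$ a propositional variable) and the following rules, where $G$ is an arbitrary, possibly empty, hypersequent: * internal weakening and contraction, on the left and on the right, and the usual rules of $\mathbf{LK}$ for $\neg$ and $\to$, all applied to one component in the context $G$; * external weakening: from $G$ infer $G\mid\Gamma\Rightarrow\Delta$; external contraction: from $G\mid\Gamma\Rightarrow\Delta\mid\Gamma\Rightarrow\Delta$ infer $G\mid\Gamma\Rightarrow\Delta$;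 * $(s5')$: from $G\mid\Gamma^{\Box},\Gamma^{O},\Gamma'\Rightarrow\Delta'$ infer $G\mid\Gamma\Rightarrow\;\mid\Gamma'\Rightarrow\Delta'$; * $(\Box L)$: from $G\mid\Gamma,\Box A,A\Rightarrow\Delta$ infer $G\mid\Gamma,\Box A\Rightarrow\Delta$; $(\Box R)$: from $G\mid\Gamma^{\Box},\Gamma^{O}\Rightarrow A$ infer $G\mid\Gamma\Rightarrow\Delta,\Box A$; * $(\bigcirc L)$: from $G\mid\Gamma,\bigcirc(B/A)\Rightarrow\Delta,A$ and $G\mid\Gamma,\bigcirc(B/A)\Rightarrow\Delta,\mathcal{B}et\,\neg A$ and $G\mid\Gamma,\bigcirc(B/A),B\Rightarrow\Delta$ infer $G\mid\Gamma,\bigcirc(B/A)\Rightarrow\Delta$; $(\bigcirc R)$: from $G\mid\Gamma^{\Box},\Gamma^{O},A,\mathcal{B}et\,\neg A\Rightarrow B$ infer $G\mid\Gamma\Rightarrow\Delta,\bigcirc(B/A)$; * $(\mathcal{B}et)$: from $G\mid\Gamma^{\Box},\Gamma^{O},\Gamma^{b\downarrow}\Rightarrow A$ infer $G\mid\Gamma\Rightarrow\Delta,\mathcal{B}et\,A$.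 The rule (cut) infers $G\mid H\mid\Gamma,\Sigma\Rightarrow\Delta,\Pi$ from $G\mid\Gamma,A\Rightarrow\Delta$ and $H\mid\Sigma\Rightarrow\Pi,A$. Then: 1. Every hypersequent that has a proof in $\mathbf{HE}$ with the addition of (cut) has a proof in $\mathbf{HE}$ without (cut). 2. (Relaxed subformula property.) For every cut-free proof of a hypersequent $H$, every formula occurring in the proof is a subformula of a formula of $H$, or is $\neg C$ or $\mathcal{B}et\,\neg C$ for some conditional obligation $\bigcirc(D/C)$ that is a subformula of a formula of $H$. -/

import Mathlib

universe u

namespace HE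

/-- Formulas of the language with `¬`, `→`, `□`, `○(·/·)` extended by the auxiliary modality `Bet`,
over an arbitrary type `α` of propositional variables. -/
inductive Formula (α : Type u) : Type u
  | var (p : α)
  | neg (A : Formula α)
  | imp (A B : Formula α)
  | box (A : Formula α)
  /-- `obl B A` is `○(B/A)`: "`B` is obligatory, given `A`". -/
  | obl (B A : Formula α)
  | bet (A : Formula α)

namespace Formula

variable {α : Type u}

/-- The formula has the form `□A`. -/
def isBox : Formula α → Bool
  | box _ => true
  | _ => false

/-- The formula has the form `○(B/A)`. -/
def isObl : Formula α → Bool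
  | obl _ _ => true
  | _ => false

/-- `Bet A ↦ A`, undefined on formulas of any other form. -/
def unBet : Formula α → Option (Formula α)
  | bet A => some A
  | _ => none

/-- `IsSubformula B A`: `B` is a subformula of `A` (possibly `A` itself). -/
inductive IsSubformula (B : Formula α) : Formula α → Prop
  | refl : IsSubformula B B
  | neg {A : Formula α} : IsSubformula B A → IsSubformula B (neg A)
  | imp_left {A C : Formula α} : IsSubformula B A → IsSubformula B (imp A C)
  | imp_right {A C : Formula α} : IsSubformula B C → IsSubformula B (imp A C)
  | box {A : Formula α} : IsSubformula B A → IsSubformula B (box A)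
  | obl_left {A C : Formula α} : IsSubformula B A → IsSubformula B (obl A C)
  | obl_right {A C : Formula α} : IsSubformula B C → IsSubformula B (obl A C)
  | bet {A : Formula α} : IsSubformula B A → IsSubformula B (bet A)

/-- The relaxed subformulas of `A`: its subformulas, together with `¬C` and `Bet ¬C` for every
conditional obligation `○(D/C)` that is a subformula of `A`. -/
def IsRelaxedSubformula (B A : Formula α) : Prop :=
  IsSubformula B A ∨
    ∃ C D : Formula α, IsSubformula (obl D C) A ∧ (B = neg C ∨ B = bet (neg C))

end Formula

/-- `Γ^□`: the multiset of the boxed formulas of `Γ`. -/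
def boxPart {α : Type u} (Γ : Multiset (Formula α)) : Multiset (Formula α) :=
  Γ.filter (fun A => A.isBox = true)

/-- `Γ^O`: the multiset of the conditional obligations of `Γ`. -/
def oblPart {α : Type u} (Γ : Multiset (Formula α)) : Multiset (Formula α) :=
  Γ.filter (fun A => A.isObl = true)

/-- `Γ^{b↓}`: the multiset of the `A` such that `Bet A` is in `Γ`. -/
def betPart {α : Type u} (Γ : Multiset (Formula α)) : Multiset (Formula α) :=
  Γ.filterMap Formula.unBet

/-- Sequents: pairs of finite multisets of formulas. -/
structure Sequent (α : Type u) : Type u where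
  ant : Multiset (Formula α)
  suc : Multiset (Formula α)

/-- Hypersequents: finite multisets of sequents. -/
abbrev Hypersequent (α : Type u) : Type u := Multiset (Sequent α)

/-- `A` is a member of the antecedent or of the succedent of some component of `H`. -/
def Hypersequent.Contains {α : Type u} (H : Hypersequent α) (A : Formula α) : Prop :=
  ∃ S ∈ H, A ∈ S.ant ∨ A ∈ S.suc

end HE

infix:50 "⟹" => HE.Sequent.mk

namespace HE

open Formula

/-- Proofs (as finite trees) in the hypersequent calculus HE with the addition of the cut rule;
`Proof H` is the type of the proofs with end-hypersequent `H`. -/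
inductive Proof {α : Type u} : Hypersequent α → Type u
  -- initial hypersequents
  | ax (p : α) (Γ Δ : Multiset (Formula α)) (G : Hypersequent α) :
      Proof ((var p ::ₘ Γ ⟹ var p ::ₘ Δ) ::ₘ G)
  -- internal structural rules
  | weakL {A : Formula α} {Γ Δ : Multiset (Formula α)} {G : Hypersequent α} :
      Proof ((Γ ⟹ Δ) ::ₘ G) → Proof ((A ::ₘ Γ ⟹ Δ) ::ₘ G)
  | weakR {A : Formula α} {Γ Δ : Multiset (Formula α)} {G : Hypersequent α} :
      Proof ((Γ ⟹ Δ) ::ₘ G) → Proof ((Γ ⟹ A ::ₘ Δ) ::ₘ G)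
  | contrL {A : Formula α} {Γ Δ : Multiset (Formula α)} {G : Hypersequent α} :
      Proof ((A ::ₘ A ::ₘ Γ ⟹ Δ) ::ₘ G) → Proof ((A ::ₘ Γ ⟹ Δ) ::ₘ G)
  | contrR {A : Formula α} {Γ Δ : Multiset (Formula α)} {G : Hypersequent α} :
      Proof ((Γ ⟹ A ::ₘ A ::ₘ Δ) ::ₘ G) → Proof ((Γ ⟹ A ::ₘ Δ) ::ₘ G)
  -- propositional rules
  | negL {A : Formula α} {Γ Δ : Multiset (Formula α)} {G : Hypersequent α} :
      Proof ((Γ ⟹ A ::ₘ Δ) ::ₘ G) → Proof ((neg A ::ₘ Γ ⟹ Δ) ::ₘ G)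
  | negR {A : Formula α} {Γ Δ : Multiset (Formula α)} {G : Hypersequent α} :
      Proof ((A ::ₘ Γ ⟹ Δ) ::ₘ G) → Proof ((Γ ⟹ neg A ::ₘ Δ) ::ₘ G)
  | impL {A B : Formula α} {Γ Δ : Multiset (Formula α)} {G : Hypersequent α} :
      Proof ((Γ ⟹ A ::ₘ Δ) ::ₘ G) → Proof ((B ::ₘ Γ ⟹ Δ) ::ₘ G) →
        Proof ((imp A B ::ₘ Γ ⟹ Δ) ::ₘ G)
  | impR {A B : Formula α} {Γ Δ : Multiset (Formula α)} {G : Hypersequent α} :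
      Proof ((A ::ₘ Γ ⟹ B ::ₘ Δ) ::ₘ G) → Proof ((Γ ⟹ imp A B ::ₘ Δ) ::ₘ G)
  -- external structural rules
  | ew {Γ Δ : Multiset (Formula α)} {G : Hypersequent α} :
      Proof G → Proof ((Γ ⟹ Δ) ::ₘ G)
  | ec {Γ Δ : Multiset (Formula α)} {G : Hypersequent α} :
      Proof ((Γ ⟹ Δ) ::ₘ (Γ ⟹ Δ) ::ₘ G) → Proof ((Γ ⟹ Δ) ::ₘ G)
  | s5 {Γ Γ' Δ' : Multiset (Formula α)} {G : Hypersequent α} :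
      Proof ((boxPart Γ + oblPart Γ + Γ' ⟹ Δ') ::ₘ G) →
        Proof ((Γ ⟹ 0) ::ₘ (Γ' ⟹ Δ') ::ₘ G)
  -- modal and deontic rules
  | boxL {A : Formula α} {Γ Δ : Multiset (Formula α)} {G : Hypersequent α} :
      Proof ((A ::ₘ box A ::ₘ Γ ⟹ Δ) ::ₘ G) → Proof ((box A ::ₘ Γ ⟹ Δ) ::ₘ G)
  | boxR {A : Formula α} {Γ Δ : Multiset (Formula α)} {G : Hypersequent α} :
      Proof ((boxPart Γ + oblPart Γ ⟹ {A}) ::ₘ G) → Proof ((Γ ⟹ box A ::ₘ Δ) ::ₘ G)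
  | oblL {A B : Formula α} {Γ Δ : Multiset (Formula α)} {G : Hypersequent α} :
      Proof ((obl B A ::ₘ Γ ⟹ A ::ₘ Δ) ::ₘ G) →
      Proof ((obl B A ::ₘ Γ ⟹ bet (neg A) ::ₘ Δ) ::ₘ G) →
      Proof ((B ::ₘ obl B A ::ₘ Γ ⟹ Δ) ::ₘ G) →
        Proof ((obl B A ::ₘ Γ ⟹ Δ) ::ₘ G)
  | oblR {A B : Formula α} {Γ Δ : Multiset (Formula α)} {G : Hypersequent α} :
      Proof ((A ::ₘ bet (neg A) ::ₘ (boxPart Γ + oblPart Γ) ⟹ {B}) ::ₘ G) →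
        Proof ((Γ ⟹ obl B A ::ₘ Δ) ::ₘ G)
  | betR {A : Formula α} {Γ Δ : Multiset (Formula α)} {G : Hypersequent α} :
      Proof ((boxPart Γ + oblPart Γ + betPart Γ ⟹ {A}) ::ₘ G) →
        Proof ((Γ ⟹ bet A ::ₘ Δ) ::ₘ G)
  -- the cut rule
  | cut {A : Formula α} {Γ Δ Γ' Δ' : Multiset (Formula α)} {G H : Hypersequent α} :
      Proof ((A ::ₘ Γ ⟹ Δ) ::ₘ G) → Proof ((Γ' ⟹ A ::ₘ Δ') ::ₘ H) →
        Proof ((Γ + Γ' ⟹ Δ + Δ') ::ₘ (G + H))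

/-- The proof contains no application of the cut rule, i.e. it is a proof in HE itself. -/
def Proof.CutFree {α : Type u} {H : Hypersequent α} : Proof H → Prop
  | .ax _ _ _ _ => True
  | .weakL d | .weakR d | .contrL d | .contrR d
  | .negL d | .negR d | .impR d
  | .ew d | .ec d | .s5 d
  | .boxL d | .boxR d | .oblR d | .betR d => d.CutFree
  | .impL d₁ d₂ => d₁.CutFree ∧ d₂.CutFree
  | .oblL d₁ d₂ d₃ => d₁.CutFree ∧ d₂.CutFree ∧ d₃.CutFree
  | .cut _ _ => False

/-- The end-hypersequent of a proof. -/
def Proof.conclusion {α : Type u} {H : Hypersequent α} (_ : Proof H) : Hypersequent α := H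

/-- The formula `A` occurs in the proof: it is contained in the end-hypersequent or
occurs in one of the subproofs of the premises of the last rule. -/
def Proof.Occurs {α : Type u} (A : Formula α) {H : Hypersequent α} : Proof H → Prop
  | e@(.ax _ _ _ _) => e.conclusion.Contains A
  | e@(.weakL d) | e@(.weakR d) | e@(.contrL d) | e@(.contrR d)
  | e@(.negL d) | e@(.negR d) | e@(.impR d)
  | e@(.ew d) | e@(.ec d) | e@(.s5 d)
  | e@(.boxL d) | e@(.boxR d) | e@(.oblR d) | e@(.betR d) =>
      e.conclusion.Contains A ∨ d.Occurs A
  | e@(.impL d₁ d₂) | e@(.cut d₁ d₂) =>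
      e.conclusion.Contains A ∨ d₁.Occurs A ∨ d₂.Occurs A
  | e@(.oblL d₁ d₂ d₃) =>
      e.conclusion.Contains A ∨ d₁.Occurs A ∨ d₂.Occurs A ∨ d₃.Occurs A

end HE

namespace HE

open Formula

variable {α : Type u}

/-! ### The relaxed subformula property -/

namespace Formula

/-! Cut elimination is obtained semantically: every rule, cut included, is sound for preference
models with an arbitrary betterness relation (`Proof.sound`), and the cut-free calculus is complete
for the same models (`provable_of_forall_valid`). Whatever is provable with cut is therefore valid,
hence provable without it; no reduction of derivations takes place.

For completeness, the components of a cut-free unprovable hypersequent are read as pairs of sets and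
extended by Zorn to a maximal set `U` of pairs covering no provable hypersequent. The worlds are the
maximal members of `U`. Read backwards, each rule becomes a closure property of these worlds.
Without cut a formula may lie on neither side of a world, so the truth lemma `canonicalModel_sat`
states two implications only: left formulas are true, right formulas are false. This suffices to
refute every component.

The relaxed subformula property is a rule-by-rule inspection, closed up by transitivity of the
relaxed subformula relation. -/

theorem IsSubformula.trans {A B C : Formula α} (hAB : IsSubformula A B) (hBC : IsSubformula B C) :
    IsSubformula A C := by
  induction hBC with
  | refl => exact hAB
  | neg _ ih => exact .neg ih
  | imp_left _ ih => exact .imp_left ih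
  | imp_right _ ih => exact .imp_right ih
  | box _ ih => exact .box ih
  | obl_left _ ih => exact .obl_left ih
  | obl_right _ ih => exact .obl_right ih
  | bet _ ih => exact .bet ih

theorem IsSubformula.relaxed {A B : Formula α} (h : IsSubformula A B) : IsRelaxedSubformula A B :=
  Or.inl h

theorem IsRelaxedSubformula.refl (A : Formula α) : IsRelaxedSubformula A A :=
  Or.inl .refl

theorem isSubformula_neg_iff {A C : Formula α} :
    IsSubformula A (neg C) ↔ A = neg C ∨ IsSubformula A C := by
  constructor
  · rintro (_ | h)
    · exact Or.inl rfl
    · exact Or.inr ‹_›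
  · rintro (rfl | h)
    · exact .refl
    · exact .neg h

theorem isSubformula_bet_iff {A C : Formula α} :
    IsSubformula A (bet C) ↔ A = bet C ∨ IsSubformula A C := by
  constructor
  · rintro (_ | h)
    · exact Or.inl rfl
    · exact Or.inr ‹_›
  · rintro (rfl | h)
    · exact .refl
    · exact .bet h

/-- The added formulas `neg E` and `bet (neg E)` have no subformulas beyond themselves and those of
`E`. In particular they bring in no new conditional obligation, so a single round of additions is
already closed. -/
theorem IsRelaxedSubformula.trans {A B C : Formula α} (hAB : IsRelaxedSubformula A B)
    (hBC : IsRelaxedSubformula B C) : IsRelaxedSubformula A C := by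
  rcases hBC with hBC | ⟨E, D, hED, hB⟩
  · rcases hAB with hAB | ⟨E, D, hED, hA⟩
    · exact Or.inl (hAB.trans hBC)
    · exact Or.inr ⟨E, D, hED.trans hBC, hA⟩
  · have key : ∀ X, IsSubformula X B → IsSubformula X E ∨ X = neg E ∨ X = bet (neg E) := by
      rintro X hX
      rcases hB with rfl | rfl
      · rcases isSubformula_neg_iff.1 hX with h | h <;> tauto
      · rcases isSubformula_bet_iff.1 hX with h | h
        · tauto
        · rcases isSubformula_neg_iff.1 h with h | h <;> tauto
    have hEC : IsSubformula E C := (IsSubformula.obl_right .refl).trans hED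
    rcases hAB with hAB | ⟨E', D', hED', hA⟩
    · rcases key A hAB with h | h
      · exact Or.inl (h.trans hEC)
      · exact Or.inr ⟨E, D, hED, h⟩
    · rcases key _ hED' with h | h | h
      · exact Or.inr ⟨E', D', h.trans hEC, hA⟩
      · cases h
      · cases h

end Formula

theorem mem_of_mem_boxPart_add_oblPart {Γ : Multiset (Formula α)} {A : Formula α}
    (h : A ∈ boxPart Γ + oblPart Γ) : A ∈ Γ := by
  rcases Multiset.mem_add.1 h with h | h
  · exact Multiset.mem_of_mem_filter h
  · exact Multiset.mem_of_mem_filter h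

theorem mem_betPart {Γ : Multiset (Formula α)} {A : Formula α} :
    A ∈ betPart Γ ↔ bet A ∈ Γ := by
  unfold betPart
  rw [Multiset.mem_filterMap]
  constructor
  · rintro ⟨B, hB, h⟩
    cases B <;> simp [unBet] at h
    exact h ▸ hB
  · exact fun h => ⟨_, h, rfl⟩

namespace Hypersequent

/-- Every formula of `H` is a relaxed subformula of a formula of `H'`. -/
def RelaxedLE (H H' : Hypersequent α) : Prop :=
  ∀ A, H.Contains A → ∃ B, H'.Contains B ∧ IsRelaxedSubformula A B

theorem contains_cons {Γ Δ : Multiset (Formula α)} {G : Hypersequent α} {A : Formula α} :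
    Contains ((Γ ⟹ Δ) ::ₘ G) A ↔ (A ∈ Γ ∨ A ∈ Δ) ∨ Contains G A := by
  simp [Contains]

theorem RelaxedLE.cons {Γ Δ Γ' Δ' : Multiset (Formula α)} (G : Hypersequent α)
    (h : ∀ A, A ∈ Γ ∨ A ∈ Δ → ∃ B, (B ∈ Γ' ∨ B ∈ Δ') ∧ IsRelaxedSubformula A B) :
    RelaxedLE ((Γ ⟹ Δ) ::ₘ G) ((Γ' ⟹ Δ') ::ₘ G) := by
  intro A hA
  rcases contains_cons.1 hA with hA | hA
  · obtain ⟨B, hB, hAB⟩ := h A hA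
    exact ⟨B, contains_cons.2 (Or.inl hB), hAB⟩
  · exact ⟨A, contains_cons.2 (Or.inr hA), .refl A⟩

theorem RelaxedLE.of_contains {H H' : Hypersequent α} (h : ∀ A, H.Contains A → H'.Contains A) :
    RelaxedLE H H' :=
  fun A hA => ⟨A, h A hA, .refl A⟩

end Hypersequent

open Hypersequent

/-- If the formulas of a hypersequent are relaxed subformulas of `H'`, then so are their relaxed
subformulas. -/
theorem Hypersequent.RelaxedLE.lift {H H' : Hypersequent α} (h : RelaxedLE H H') {B : Formula α}
    (hB : ∃ A, H.Contains A ∧ IsRelaxedSubformula B A) :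
    ∃ A, H'.Contains A ∧ IsRelaxedSubformula B A := by
  obtain ⟨A, hA, hBA⟩ := hB
  obtain ⟨C, hC, hAC⟩ := h A hA
  exact ⟨C, hC, hBA.trans hAC⟩

/-- In every rule but cut, each premise formula is a relaxed subformula of a formula in the
conclusion. Plain subformulas fail only for `bet (neg A)` in the rules `oblL` and `oblR`. -/
theorem Proof.CutFree.isRelaxedSubformula_of_occurs {H : Hypersequent α} (d : Proof H)
    (hd : d.CutFree) (B : Formula α) (hB : d.Occurs B) :
    ∃ A, H.Contains A ∧ IsRelaxedSubformula B A := by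
  have self : ∀ {H : Hypersequent α}, H.Contains B →
      ∃ A, H.Contains A ∧ IsRelaxedSubformula B A := fun h => ⟨B, h, .refl B⟩
  induction d with
  | ax p Γ Δ G => exact self hB
  | @weakL A Γ Δ G d ih =>
    rcases hB with hB | hB
    · exact self hB
    refine RelaxedLE.lift (RelaxedLE.of_contains fun X => ?_) (ih hd hB)
    simp only [contains_cons, Multiset.mem_cons]
    tauto
  | @weakR A Γ Δ G d ih =>
    rcases hB with hB | hB
    · exact self hB
    refine RelaxedLE.lift (RelaxedLE.of_contains fun X => ?_) (ih hd hB)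
    simp only [contains_cons, Multiset.mem_cons]
    tauto
  | @contrL A Γ Δ G d ih =>
    rcases hB with hB | hB
    · exact self hB
    refine RelaxedLE.lift (RelaxedLE.of_contains fun X => ?_) (ih hd hB)
    simp only [contains_cons, Multiset.mem_cons]
    tauto
  | @contrR A Γ Δ G d ih =>
    rcases hB with hB | hB
    · exact self hB
    refine RelaxedLE.lift (RelaxedLE.of_contains fun X => ?_) (ih hd hB)
    simp only [contains_cons, Multiset.mem_cons]
    tauto
  | @negL A Γ Δ G d ih =>
    rcases hB with hB | hB
    · exact self hB
    refine RelaxedLE.lift (RelaxedLE.cons G fun X hX => ?_) (ih hd hB)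
    rcases hX with hX | hX
    · exact ⟨X, by simp [hX], .refl X⟩
    · rcases Multiset.mem_cons.1 hX with rfl | hX
      · exact ⟨neg X, by simp, (IsSubformula.neg .refl).relaxed⟩
      · exact ⟨X, by simp [hX], .refl X⟩
  | @negR A Γ Δ G d ih =>
    rcases hB with hB | hB
    · exact self hB
    refine RelaxedLE.lift (RelaxedLE.cons G fun X hX => ?_) (ih hd hB)
    rcases hX with hX | hX
    · rcases Multiset.mem_cons.1 hX with rfl | hX
      · exact ⟨neg X, by simp, (IsSubformula.neg .refl).relaxed⟩
      · exact ⟨X, by simp [hX], .refl X⟩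
    · exact ⟨X, by simp [hX], .refl X⟩
  | @impL A C Γ Δ G d₁ d₂ ih₁ ih₂ =>
    rcases hB with hB | hB | hB
    · exact self hB
    · refine RelaxedLE.lift (RelaxedLE.cons G fun X hX => ?_) (ih₁ hd.1 hB)
      rcases hX with hX | hX
      · exact ⟨X, by simp [hX], .refl X⟩
      · rcases Multiset.mem_cons.1 hX with rfl | hX
        · exact ⟨imp X C, by simp, (IsSubformula.imp_left .refl).relaxed⟩
        · exact ⟨X, by simp [hX], .refl X⟩
    · refine RelaxedLE.lift (RelaxedLE.cons G fun X hX => ?_) (ih₂ hd.2 hB)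
      rcases hX with hX | hX
      · rcases Multiset.mem_cons.1 hX with rfl | hX
        · exact ⟨imp A X, by simp, (IsSubformula.imp_right .refl).relaxed⟩
        · exact ⟨X, by simp [hX], .refl X⟩
      · exact ⟨X, by simp [hX], .refl X⟩
  | @impR A C Γ Δ G d ih =>
    rcases hB with hB | hB
    · exact self hB
    refine RelaxedLE.lift (RelaxedLE.cons G fun X hX => ?_) (ih hd hB)
    rcases hX with hX | hX
    · rcases Multiset.mem_cons.1 hX with rfl | hX
      · exact ⟨imp X C, by simp, (IsSubformula.imp_left .refl).relaxed⟩
      · exact ⟨X, by simp [hX], .refl X⟩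
    · rcases Multiset.mem_cons.1 hX with rfl | hX
      · exact ⟨imp A X, by simp, (IsSubformula.imp_right .refl).relaxed⟩
      · exact ⟨X, by simp [hX], .refl X⟩
  | @ew Γ Δ G d ih =>
    rcases hB with hB | hB
    · exact self hB
    refine RelaxedLE.lift (RelaxedLE.of_contains fun X => ?_) (ih hd hB)
    simp only [contains_cons]
    tauto
  | @ec Γ Δ G d ih =>
    rcases hB with hB | hB
    · exact self hB
    refine RelaxedLE.lift (RelaxedLE.of_contains fun X => ?_) (ih hd hB)
    simp only [contains_cons]
    tauto
  | @s5 Γ Γ' Δ' G d ih =>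
    rcases hB with hB | hB
    · exact self hB
    refine RelaxedLE.lift (RelaxedLE.of_contains fun X => ?_) (ih hd hB)
    have := @mem_of_mem_boxPart_add_oblPart _ Γ X
    simp only [contains_cons, Multiset.mem_add (s := boxPart Γ + oblPart Γ)]
    tauto
  | @boxL A Γ Δ G d ih =>
    rcases hB with hB | hB
    · exact self hB
    refine RelaxedLE.lift (RelaxedLE.cons G fun X hX => ?_) (ih hd hB)
    rcases hX with hX | hX
    · rcases Multiset.mem_cons.1 hX with rfl | hX
      · exact ⟨box X, by simp, (IsSubformula.box .refl).relaxed⟩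
      · exact ⟨X, Or.inl hX, .refl X⟩
    · exact ⟨X, Or.inr hX, .refl X⟩
  | @boxR A Γ Δ G d ih =>
    rcases hB with hB | hB
    · exact self hB
    refine RelaxedLE.lift (RelaxedLE.cons G fun X hX => ?_) (ih hd hB)
    rcases hX with hX | hX
    · exact ⟨X, Or.inl (mem_of_mem_boxPart_add_oblPart hX), .refl X⟩
    · obtain rfl := Multiset.mem_singleton.1 hX
      exact ⟨box X, by simp, (IsSubformula.box .refl).relaxed⟩
  | @oblL A C Γ Δ G d₁ d₂ d₃ ih₁ ih₂ ih₃ =>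
    rcases hB with hB | hB | hB | hB
    · exact self hB
    · refine RelaxedLE.lift (RelaxedLE.cons G fun X hX => ?_) (ih₁ hd.1 hB)
      rcases hX with hX | hX
      · exact ⟨X, Or.inl hX, .refl X⟩
      · rcases Multiset.mem_cons.1 hX with rfl | hX
        · exact ⟨obl C X, by simp, (IsSubformula.obl_right .refl).relaxed⟩
        · exact ⟨X, Or.inr hX, .refl X⟩
    · refine RelaxedLE.lift (RelaxedLE.cons G fun X hX => ?_) (ih₂ hd.2.1 hB)
      rcases hX with hX | hX
      · exact ⟨X, Or.inl hX, .refl X⟩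
      · rcases Multiset.mem_cons.1 hX with rfl | hX
        · exact ⟨obl C A, by simp, Or.inr ⟨A, C, .refl, Or.inr rfl⟩⟩
        · exact ⟨X, Or.inr hX, .refl X⟩
    · refine RelaxedLE.lift (RelaxedLE.cons G fun X hX => ?_) (ih₃ hd.2.2 hB)
      rcases hX with hX | hX
      · rcases Multiset.mem_cons.1 hX with rfl | hX
        · exact ⟨obl X A, by simp, (IsSubformula.obl_left .refl).relaxed⟩
        · exact ⟨X, Or.inl hX, .refl X⟩
      · exact ⟨X, Or.inr hX, .refl X⟩
  | @oblR A C Γ Δ G d ih =>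
    rcases hB with hB | hB
    · exact self hB
    refine RelaxedLE.lift (RelaxedLE.cons G fun X hX => ?_) (ih hd hB)
    rcases hX with hX | hX
    · rcases Multiset.mem_cons.1 hX with rfl | hX
      · exact ⟨obl C X, by simp, (IsSubformula.obl_right .refl).relaxed⟩
      · rcases Multiset.mem_cons.1 hX with rfl | hX
        · exact ⟨obl C A, by simp, Or.inr ⟨A, C, .refl, Or.inr rfl⟩⟩
        · exact ⟨X, Or.inl (mem_of_mem_boxPart_add_oblPart hX), .refl X⟩
    · obtain rfl := Multiset.mem_singleton.1 hX
      exact ⟨obl X A, by simp, (IsSubformula.obl_left .refl).relaxed⟩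
  | @betR A Γ Δ G d ih =>
    rcases hB with hB | hB
    · exact self hB
    refine RelaxedLE.lift (RelaxedLE.cons G fun X hX => ?_) (ih hd hB)
    rcases hX with hX | hX
    · rcases Multiset.mem_add.1 hX with hX | hX
      · exact ⟨X, Or.inl (mem_of_mem_boxPart_add_oblPart hX), .refl X⟩
      · exact ⟨bet X, Or.inl (mem_betPart.1 hX), (IsSubformula.bet .refl).relaxed⟩
    · obtain rfl := Multiset.mem_singleton.1 hX
      exact ⟨bet X, by simp, (IsSubformula.bet .refl).relaxed⟩
  | cut _ _ => exact hd.elim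

/-! ### Preference models and soundness -/

/-- A preference model: `better w v` says that `v` is better than `w`. -/
structure Model (α : Type u) : Type (u + 1) where
  World : Type u
  better : World → World → Prop
  val : World → α → Prop

namespace Model

/-- Truth at a world; `○(B/A)` says that `B` holds at all best `A`-worlds. -/
def Sat (M : Model α) : M.World → Formula α → Prop
  | w, var p => M.val w p
  | w, neg A => ¬ M.Sat w A
  | w, imp A B => M.Sat w A → M.Sat w B
  | _, box A => ∀ v, M.Sat v A
  | _, obl B A => ∀ v, M.Sat v A → (∀ u, M.better v u → ¬ M.Sat u A) → M.Sat v B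
  | w, bet A => ∀ v, M.better w v → M.Sat v A

/-- The sequent holds at every world of the model. -/
def ValidSeq (M : Model α) (S : Sequent α) : Prop :=
  ∀ w, (∀ A ∈ S.ant, M.Sat w A) → ∃ A ∈ S.suc, M.Sat w A

/-- Some component of the hypersequent holds at every world of the model. -/
def Valid (M : Model α) (H : Hypersequent α) : Prop :=
  ∃ S ∈ H, M.ValidSeq S

theorem valid_cons {M : Model α} {S : Sequent α} {H : Hypersequent α} :
    M.Valid (S ::ₘ H) ↔ M.ValidSeq S ∨ M.Valid H := by
  simp [Valid]

theorem validSeq_mk {M : Model α} {Γ Δ : Multiset (Formula α)} :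
    M.ValidSeq (Γ ⟹ Δ) ↔ ∀ w, (∀ A ∈ Γ, M.Sat w A) → ∃ A ∈ Δ, M.Sat w A :=
  Iff.rfl

theorem exists_sat_cons {M : Model α} {Δ : Multiset (Formula α)} {w : M.World} {B : Formula α} :
    (∃ A ∈ B ::ₘ Δ, M.Sat w A) ↔ M.Sat w B ∨ ∃ A ∈ Δ, M.Sat w A := by
  simp

theorem Valid.cons_imp {M : Model α} {S T : Sequent α} {G : Hypersequent α}
    (h : M.Valid (S ::ₘ G)) (hST : M.ValidSeq S → M.ValidSeq T) : M.Valid (T ::ₘ G) :=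
  valid_cons.2 ((valid_cons.1 h).imp_left hST)

/-- Boxed formulas and conditional obligations are true everywhere if they are true somewhere. -/
theorem sat_boxPart_add_oblPart {M : Model α} {Γ : Multiset (Formula α)} {w : M.World}
    (h : ∀ A ∈ Γ, M.Sat w A) (v : M.World) : ∀ A ∈ boxPart Γ + oblPart Γ, M.Sat v A := by
  intro A hA
  have hw := h A (mem_of_mem_boxPart_add_oblPart hA)
  cases A with
  | box A => exact hw
  | obl B A => exact hw
  | _ =>
    rcases Multiset.mem_add.1 hA with hA | hA
    · cases (Multiset.mem_filter.1 hA).2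
    · cases (Multiset.mem_filter.1 hA).2

end Model

open Model

/-- Validity asks for one component true at all worlds, so a valid context settles a rule at once
and only the active components need an argument. -/
theorem Proof.sound (M : Model α) {H : Hypersequent α} (d : Proof H) : M.Valid H := by
  induction d with
  | ax p Γ Δ G => exact valid_cons.2 (Or.inl fun w h => ⟨var p, by simp, h _ (by simp)⟩)
  | weakL d ih =>
    exact ih.cons_imp fun h w hw => h w fun A hA => hw A (Multiset.mem_cons_of_mem hA)
  | weakR d ih =>
    refine ih.cons_imp fun h w hw => ?_
    obtain ⟨A, hA, hs⟩ := h w hw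
    exact ⟨A, Multiset.mem_cons_of_mem hA, hs⟩
  | contrL d ih =>
    refine ih.cons_imp fun h w hw => h w fun A hA => hw A ?_
    simpa using hA
  | contrR d ih =>
    refine ih.cons_imp fun h w hw => ?_
    obtain ⟨A, hA, hs⟩ := h w hw
    exact ⟨A, by simpa using hA, hs⟩
  | negL d ih =>
    refine ih.cons_imp fun h w hw => ?_
    simp only [validSeq_mk, Multiset.forall_mem_cons, exists_sat_cons, Sat] at h hw ⊢
    exact (h w hw.2).resolve_left hw.1
  | negR d ih =>
    refine ih.cons_imp fun h w hw => ?_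
    simp only [validSeq_mk, Multiset.forall_mem_cons, exists_sat_cons, Sat] at h hw ⊢
    exact or_iff_not_imp_left.2 fun hA => h w ⟨not_not.1 hA, hw⟩
  | impL d₁ d₂ ih₁ ih₂ =>
    rcases valid_cons.1 ih₁ with h₁ | h₁
    · refine ih₂.cons_imp fun h₂ w hw => ?_
      simp only [validSeq_mk, Multiset.forall_mem_cons, exists_sat_cons, Sat]
        at h₁ h₂ hw ⊢
      rcases h₁ w hw.2 with hA | hΔ
      · exact h₂ w ⟨hw.1 hA, hw.2⟩
      · exact hΔ
    · exact valid_cons.2 (Or.inr h₁)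
  | impR d ih =>
    refine ih.cons_imp fun h w hw => ?_
    simp only [validSeq_mk, Multiset.forall_mem_cons, exists_sat_cons, Sat] at h hw ⊢
    have := h w
    tauto
  | ew d ih => exact valid_cons.2 (Or.inr ih)
  | ec d ih => exact (valid_cons.1 ih).elim (fun h => valid_cons.2 (Or.inl h)) id
  | s5 d ih =>
    rcases valid_cons.1 ih with h | h
    -- If `Γ ⟹ 0` fails, all of `Γ` holds at some `w`; its boxed formulas and obligations then hold
    -- at every world and can be dropped from the premise.
    · refine valid_cons.2 (or_iff_not_imp_left.2 fun hn => valid_cons.2 (Or.inl fun v hv => ?_))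
      simp only [validSeq_mk] at hn
      push Not at hn
      obtain ⟨w, hw, -⟩ := hn
      refine h v fun A hA => ?_
      rcases Multiset.mem_add.1 hA with hA | hA
      · exact sat_boxPart_add_oblPart hw v A hA
      · exact hv A hA
    · exact valid_cons.2 (Or.inr (valid_cons.2 (Or.inr h)))
  | boxL d ih =>
    refine ih.cons_imp fun h w hw => h w ?_
    simp only [Multiset.forall_mem_cons, Sat] at hw ⊢
    exact ⟨hw.1 w, hw⟩
  | boxR d ih =>
    refine ih.cons_imp fun h w hw => ⟨_, Multiset.mem_cons_self _ _, fun v => ?_⟩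
    simpa using h v (sat_boxPart_add_oblPart hw v)
  | oblL d₁ d₂ d₃ ih₁ ih₂ ih₃ =>
    rcases valid_cons.1 ih₁ with h₁ | h₁
    · rcases valid_cons.1 ih₂ with h₂ | h₂
      · refine ih₃.cons_imp fun h₃ w hw => ?_
        simp only [validSeq_mk, Multiset.forall_mem_cons, exists_sat_cons, Sat]
          at h₁ h₂ h₃ hw ⊢
        -- Truth of `A` and of `bet (neg A)` at `w` says exactly that `w` is a best `A`-world, so
        -- the obligation applies there.
        rcases h₁ w hw with hA | hΔ
        · rcases h₂ w hw with hb | hΔ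
          · exact h₃ w ⟨hw.1 w hA hb, hw⟩
          · exact hΔ
        · exact hΔ
      · exact valid_cons.2 (Or.inr h₂)
    · exact valid_cons.2 (Or.inr h₁)
  | oblR d ih =>
    refine ih.cons_imp fun h w hw => ⟨_, Multiset.mem_cons_self _ _, fun v hA hb => ?_⟩
    have := h v
    simp only [Multiset.forall_mem_cons, Multiset.mem_singleton, exists_eq_left] at this
    exact this ⟨hA, hb, sat_boxPart_add_oblPart hw v⟩
  | betR d ih =>
    refine ih.cons_imp fun h w hw => ⟨_, Multiset.mem_cons_self _ _, fun v hv => ?_⟩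
    have := h v
    simp only [Multiset.mem_singleton, exists_eq_left] at this
    refine this fun A hA => ?_
    rcases Multiset.mem_add.1 hA with hA | hA
    · exact sat_boxPart_add_oblPart hw v A hA
    · exact hw _ (mem_betPart.1 hA) v hv
  | @cut A Γ Δ Γ' Δ' G H d₁ d₂ ih₁ ih₂ =>
    rcases valid_cons.1 ih₁ with h₁ | ⟨S, hS, h⟩
    · rcases valid_cons.1 ih₂ with h₂ | ⟨S, hS, h⟩
      · refine valid_cons.2 (Or.inl fun w hw => ?_)
        simp only [validSeq_mk, Multiset.forall_mem_cons, exists_sat_cons] at h₁ h₂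
        have hΓ : ∀ B ∈ Γ, M.Sat w B := fun B hB => hw B (Multiset.mem_add.2 (Or.inl hB))
        have hΓ' : ∀ B ∈ Γ', M.Sat w B := fun B hB => hw B (Multiset.mem_add.2 (Or.inr hB))
        rcases h₂ w hΓ' with hA | ⟨B, hB, hs⟩
        · obtain ⟨B, hB, hs⟩ := h₁ w ⟨hA, hΓ⟩
          exact ⟨B, Multiset.mem_add.2 (Or.inl hB), hs⟩
        · exact ⟨B, Multiset.mem_add.2 (Or.inr hB), hs⟩
      · exact valid_cons.2 (Or.inr ⟨S, Multiset.mem_add.2 (Or.inr hS), h⟩)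
    · exact valid_cons.2 (Or.inr ⟨S, Multiset.mem_add.2 (Or.inl hS), h⟩)

/-! ### Cut-free provability -/

/-- The hypersequent has a cut-free proof. -/
def Provable (H : Hypersequent α) : Prop :=
  ∃ d : Proof H, d.CutFree

namespace Provable

variable {A B : Formula α} {Γ Γ' Δ Δ' : Multiset (Formula α)} {G H : Hypersequent α}

theorem ax (p : α) (Γ Δ : Multiset (Formula α)) (G : Hypersequent α) :
    Provable ((var p ::ₘ Γ ⟹ var p ::ₘ Δ) ::ₘ G) :=
  ⟨.ax p Γ Δ G, trivial⟩

theorem weakL : Provable ((Γ ⟹ Δ) ::ₘ G) → Provable ((A ::ₘ Γ ⟹ Δ) ::ₘ G) :=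
  fun ⟨d, h⟩ => ⟨.weakL d, h⟩

theorem weakR : Provable ((Γ ⟹ Δ) ::ₘ G) → Provable ((Γ ⟹ A ::ₘ Δ) ::ₘ G) :=
  fun ⟨d, h⟩ => ⟨.weakR d, h⟩

theorem contrL : Provable ((A ::ₘ A ::ₘ Γ ⟹ Δ) ::ₘ G) → Provable ((A ::ₘ Γ ⟹ Δ) ::ₘ G) :=
  fun ⟨d, h⟩ => ⟨.contrL d, h⟩

theorem contrR : Provable ((Γ ⟹ A ::ₘ A ::ₘ Δ) ::ₘ G) → Provable ((Γ ⟹ A ::ₘ Δ) ::ₘ G) :=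
  fun ⟨d, h⟩ => ⟨.contrR d, h⟩

theorem negL : Provable ((Γ ⟹ A ::ₘ Δ) ::ₘ G) → Provable ((neg A ::ₘ Γ ⟹ Δ) ::ₘ G) :=
  fun ⟨d, h⟩ => ⟨.negL d, h⟩

theorem negR : Provable ((A ::ₘ Γ ⟹ Δ) ::ₘ G) → Provable ((Γ ⟹ neg A ::ₘ Δ) ::ₘ G) :=
  fun ⟨d, h⟩ => ⟨.negR d, h⟩

theorem impL : Provable ((Γ ⟹ A ::ₘ Δ) ::ₘ G) → Provable ((B ::ₘ Γ ⟹ Δ) ::ₘ G) →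
    Provable ((imp A B ::ₘ Γ ⟹ Δ) ::ₘ G) :=
  fun ⟨d₁, h₁⟩ ⟨d₂, h₂⟩ => ⟨.impL d₁ d₂, h₁, h₂⟩

theorem impR : Provable ((A ::ₘ Γ ⟹ B ::ₘ Δ) ::ₘ G) → Provable ((Γ ⟹ imp A B ::ₘ Δ) ::ₘ G) :=
  fun ⟨d, h⟩ => ⟨.impR d, h⟩

theorem ew : Provable G → Provable ((Γ ⟹ Δ) ::ₘ G) :=
  fun ⟨d, h⟩ => ⟨.ew d, h⟩

theorem ec : Provable ((Γ ⟹ Δ) ::ₘ (Γ ⟹ Δ) ::ₘ G) → Provable ((Γ ⟹ Δ) ::ₘ G) :=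
  fun ⟨d, h⟩ => ⟨.ec d, h⟩

theorem s5 : Provable ((boxPart Γ + oblPart Γ + Γ' ⟹ Δ') ::ₘ G) →
    Provable ((Γ ⟹ 0) ::ₘ (Γ' ⟹ Δ') ::ₘ G) :=
  fun ⟨d, h⟩ => ⟨.s5 d, h⟩

theorem boxL : Provable ((A ::ₘ box A ::ₘ Γ ⟹ Δ) ::ₘ G) → Provable ((box A ::ₘ Γ ⟹ Δ) ::ₘ G) :=
  fun ⟨d, h⟩ => ⟨.boxL d, h⟩

theorem boxR : Provable ((boxPart Γ + oblPart Γ ⟹ {A}) ::ₘ G) →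
    Provable ((Γ ⟹ box A ::ₘ Δ) ::ₘ G) :=
  fun ⟨d, h⟩ => ⟨.boxR d, h⟩

theorem oblL : Provable ((obl B A ::ₘ Γ ⟹ A ::ₘ Δ) ::ₘ G) →
    Provable ((obl B A ::ₘ Γ ⟹ bet (neg A) ::ₘ Δ) ::ₘ G) →
    Provable ((B ::ₘ obl B A ::ₘ Γ ⟹ Δ) ::ₘ G) → Provable ((obl B A ::ₘ Γ ⟹ Δ) ::ₘ G) :=
  fun ⟨d₁, h₁⟩ ⟨d₂, h₂⟩ ⟨d₃, h₃⟩ => ⟨.oblL d₁ d₂ d₃, h₁, h₂, h₃⟩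

theorem oblR : Provable ((A ::ₘ bet (neg A) ::ₘ (boxPart Γ + oblPart Γ) ⟹ {B}) ::ₘ G) →
    Provable ((Γ ⟹ obl B A ::ₘ Δ) ::ₘ G) :=
  fun ⟨d, h⟩ => ⟨.oblR d, h⟩

theorem betR : Provable ((boxPart Γ + oblPart Γ + betPart Γ ⟹ {A}) ::ₘ G) →
    Provable ((Γ ⟹ bet A ::ₘ Δ) ::ₘ G) :=
  fun ⟨d, h⟩ => ⟨.betR d, h⟩

/-- Weaken to `Γ + Γ'`, then contract each member of `Γ` into its copy in `Γ'`. As multiset `⊆`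
ignores multiplicity, antecedents behave as sets from here on. -/
theorem monoL (hΓ : Γ ⊆ Γ') (h : Provable ((Γ ⟹ Δ) ::ₘ G)) : Provable ((Γ' ⟹ Δ) ::ₘ G) := by
  have weak : Provable ((Γ + Γ' ⟹ Δ) ::ₘ G) := by
    clear hΓ
    induction Γ' using Multiset.induction with
    | empty => simpa using h
    | cons A Γ' ih => simpa using ih.weakL (A := A)
  clear h
  induction Γ using Multiset.induction with
  | empty => simpa using weak
  | cons A Γ ih =>
    obtain ⟨hA, hΓ⟩ := Multiset.cons_subset.1 hΓ
    refine ih hΓ ?_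
    obtain ⟨Θ, rfl⟩ := Multiset.exists_cons_of_mem hA
    rw [Multiset.add_cons]
    apply contrL
    simpa using weak

theorem monoR (hΔ : Δ ⊆ Δ') (h : Provable ((Γ ⟹ Δ) ::ₘ G)) : Provable ((Γ ⟹ Δ') ::ₘ G) := by
  have weak : Provable ((Γ ⟹ Δ + Δ') ::ₘ G) := by
    clear hΔ
    induction Δ' using Multiset.induction with
    | empty => simpa using h
    | cons A Δ' ih => simpa using ih.weakR (A := A)
  clear h
  induction Δ using Multiset.induction with
  | empty => simpa using weak
  | cons A Δ ih =>
    obtain ⟨hA, hΔ⟩ := Multiset.cons_subset.1 hΔ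
    refine ih hΔ ?_
    obtain ⟨Θ, rfl⟩ := Multiset.exists_cons_of_mem hA
    rw [Multiset.add_cons]
    apply contrR
    simpa using weak

/-- Provability is preserved if every component is contained, as a pair of sets, in a component of
the new hypersequent. -/
theorem mono (hGH : ∀ S ∈ G, ∃ T ∈ H, S.ant ⊆ T.ant ∧ S.suc ⊆ T.suc) (h : Provable G) :
    Provable H := by
  have weak : Provable (G + H) := by
    clear hGH
    induction H using Multiset.induction with
    | empty => simpa using h
    | cons S H ih => simpa using ih.ew (Γ := S.ant) (Δ := S.suc)
  clear h
  induction G using Multiset.induction with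
  | empty => simpa using weak
  | cons S G ih =>
    obtain ⟨⟨T, hT, hl, hr⟩, hG⟩ := Multiset.forall_mem_cons.1 hGH
    refine ih hG ?_
    obtain ⟨K, rfl⟩ := Multiset.exists_cons_of_mem hT
    rw [Multiset.add_cons]
    apply ec
    rw [Multiset.cons_add, Multiset.add_cons] at weak
    -- Enlarging `S` to `T` produces a second copy of `T`, ready for external contraction.
    exact (monoL (Γ := S.ant) (Δ := S.suc) hl weak).monoR hr

theorem mono_cons (hΓ : Γ ⊆ Γ') (hΔ : Δ ⊆ Δ') (hGH : G ≤ H) (h : Provable ((Γ ⟹ Δ) ::ₘ G)) :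
    Provable ((Γ' ⟹ Δ') ::ₘ H) := by
  refine h.mono (Multiset.forall_mem_cons.2 ⟨⟨_, Multiset.mem_cons_self _ _, hΓ, hΔ⟩, ?_⟩)
  exact fun S hS => ⟨S, Multiset.mem_cons_of_mem (Multiset.mem_of_le hGH hS),
    fun _ => id, fun _ => id⟩

end Provable

/-! ### The canonical model -/

/-- A possibly infinite sequent, as a pair of sets of formulas. -/
abbrev SetSequent (α : Type u) : Type u := Set (Formula α) × Set (Formula α)

/-- All formulas of the two multisets lie in the corresponding set. -/
def SetSequent.Covers (s : SetSequent α) (S : Sequent α) : Prop :=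
  (∀ A ∈ S.ant, A ∈ s.1) ∧ ∀ A ∈ S.suc, A ∈ s.2

/-- Every component of the hypersequent is covered by a member of `U`. -/
def Covers (U : Set (SetSequent α)) (G : Hypersequent α) : Prop :=
  ∀ S ∈ G, ∃ s ∈ U, s.Covers S

/-- No hypersequent covered by `U` is cut-free provable. -/
def Consistent (U : Set (SetSequent α)) : Prop :=
  ∀ G, Covers U G → ¬ Provable G

theorem covers_cons {U : Set (SetSequent α)} {S : Sequent α} {G : Hypersequent α} :
    Covers U (S ::ₘ G) ↔ (∃ s ∈ U, s.Covers S) ∧ Covers U G := by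
  simp [Covers]

theorem Covers.add {U : Set (SetSequent α)} {G H : Hypersequent α} (hG : Covers U G)
    (hH : Covers U H) : Covers U (G + H) := by
  intro S hS
  exact (Multiset.mem_add.1 hS).elim (hG S) (hH S)

/-- A hypersequent has finitely many components, so one covered by the union of a chain is covered
by a single member of the chain. -/
theorem exists_maximal_consistent {U : Set (SetSequent α)} (hU : Consistent U) :
    ∃ V, U ⊆ V ∧ Maximal Consistent V := by
  refine zorn_subset_nonempty {V | Consistent V} ?_ U hU
  intro c hc hchain ⟨V₀, hV₀⟩
  refine ⟨⋃₀ c, fun G hG => ?_, fun V hV => Set.subset_sUnion_of_mem hV⟩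
  have : ∃ V ∈ c, Covers V G := by
    induction G using Multiset.induction with
    | empty => exact ⟨V₀, hV₀, by simp [Covers]⟩
    | cons S G ih =>
      obtain ⟨⟨s, ⟨V, hV, hs⟩, hsS⟩, hG⟩ := covers_cons.1 hG
      obtain ⟨V', hV', hG'⟩ := ih hG
      rcases hchain.total hV hV' with h | h
      · exact ⟨V', hV', covers_cons.2 ⟨⟨s, h hs, hsS⟩, hG'⟩⟩
      · refine ⟨V, hV, covers_cons.2 ⟨⟨s, hs, hsS⟩, fun T hT => ?_⟩⟩
        obtain ⟨t, ht, htT⟩ := hG' T hT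
        exact ⟨t, h ht, htT⟩
  obtain ⟨V, hV, hVG⟩ := this
  exact hc hV G hVG

/-! ### Saturation: the rules read backwards as closure properties of maximal members. -/

section Saturation

variable {U : Set (SetSequent α)} {w : SetSequent α}

/-- This is the means of creating new members of `U`. In a provable hypersequent covered by `insert
s U`, the components covered by `s` can be merged into one, and the rest is a context covered by
`U`. -/
theorem mem_of_not_provable (hU : Maximal Consistent U) {s : SetSequent α}
    (h : ∀ Γ Δ G, s.Covers (Γ ⟹ Δ) → Covers U G → ¬ Provable ((Γ ⟹ Δ) ::ₘ G)) : s ∈ U := by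
  refine hU.2 (y := insert s U) ?_ (Set.subset_insert s U) (Set.mem_insert s U)
  intro X hX hprov
  have : ∃ Γ Δ G, s.Covers (Γ ⟹ Δ) ∧ Covers U G ∧
      ∀ S ∈ X, ∃ T ∈ (Γ ⟹ Δ) ::ₘ G, S.ant ⊆ T.ant ∧ S.suc ⊆ T.suc := by
    clear hprov
    induction X using Multiset.induction with
    | empty => exact ⟨0, 0, 0, by simp [SetSequent.Covers], by simp [Covers], by simp⟩
    | cons S X ih =>
      obtain ⟨⟨t, ht, htS⟩, hX⟩ := covers_cons.1 hX
      obtain ⟨Γ, Δ, G, hs, hG, hle⟩ := ih hX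
      rcases ht with rfl | ht
      -- A component covered by `s` is absorbed into the merged one, which `s` still covers.
      · refine ⟨S.ant + Γ, S.suc + Δ, G, ⟨?_, ?_⟩, hG, ?_⟩
        · intro A hA
          exact (Multiset.mem_add.1 hA).elim (htS.1 A) (hs.1 A)
        · intro A hA
          exact (Multiset.mem_add.1 hA).elim (htS.2 A) (hs.2 A)
        · refine Multiset.forall_mem_cons.2 ⟨⟨_, Multiset.mem_cons_self _ _, ?_, ?_⟩, ?_⟩
          · exact Multiset.subset_of_le (Multiset.le_add_right _ _)
          · exact Multiset.subset_of_le (Multiset.le_add_right _ _)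
          · intro T hT
            obtain ⟨T', hT', h₁, h₂⟩ := hle T hT
            rcases Multiset.mem_cons.1 hT' with rfl | hT'
            · exact ⟨_, Multiset.mem_cons_self _ _,
                fun A hA => Multiset.mem_add.2 (Or.inr (h₁ hA)),
                fun A hA => Multiset.mem_add.2 (Or.inr (h₂ hA))⟩
            · exact ⟨T', Multiset.mem_cons_of_mem hT', h₁, h₂⟩
      · refine ⟨Γ, Δ, S ::ₘ G, hs, covers_cons.2 ⟨⟨t, ht, htS⟩, hG⟩, ?_⟩
        refine Multiset.forall_mem_cons.2 ⟨⟨S, by simp, fun _ => id, fun _ => id⟩, ?_⟩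
        intro T hT
        obtain ⟨T', hT', h⟩ := hle T hT
        refine ⟨T', ?_, h⟩
        simp only [Multiset.mem_cons] at hT' ⊢
        tauto
  obtain ⟨Γ, Δ, G, hs, hG, hle⟩ := this
  exact h Γ Δ G hs hG (hprov.mono hle)

/-- Zorn again: the componentwise union of a chain stays in `U`, because a finite sequent covered by
the union is already covered by one member of the chain. -/
theorem exists_maximal_ge (hU : Maximal Consistent U) {s : SetSequent α} (hs : s ∈ U) :
    ∃ t, s ≤ t ∧ Maximal (· ∈ U) t := by
  refine zorn_le_nonempty₀ U ?_ s hs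
  intro c hc hchain s₀ hs₀
  refine ⟨(⋃ t ∈ c, t.1, ⋃ t ∈ c, t.2), ?_, fun t ht =>
    ⟨Set.subset_biUnion_of_mem (u := fun t : SetSequent α => t.1) ht,
      Set.subset_biUnion_of_mem (u := fun t : SetSequent α => t.2) ht⟩⟩
  refine mem_of_not_provable hU fun Γ Δ G hcov hG => ?_
  obtain ⟨h₁, h₂⟩ := hcov
  have hl : ∃ t ∈ c, ∀ A ∈ Γ, A ∈ t.1 := by
    clear h₂
    dsimp only at h₁
    induction Γ using Multiset.induction with
    | empty => exact ⟨s₀, hs₀, by simp⟩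
    | cons A Γ ih =>
      obtain ⟨hA, hΓ⟩ := Multiset.forall_mem_cons.1 h₁
      obtain ⟨t, ht, hAt⟩ := Set.mem_iUnion₂.1 hA
      obtain ⟨t', ht', hΓt'⟩ := ih hΓ
      rcases hchain.total ht ht' with h | h
      · exact ⟨t', ht', Multiset.forall_mem_cons.2 ⟨h.1 hAt, hΓt'⟩⟩
      · exact ⟨t, ht, Multiset.forall_mem_cons.2 ⟨hAt, fun B hB => h.1 (hΓt' B hB)⟩⟩
  have hr : ∃ t ∈ c, ∀ A ∈ Δ, A ∈ t.2 := by
    clear h₁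
    dsimp only at h₂
    induction Δ using Multiset.induction with
    | empty => exact ⟨s₀, hs₀, by simp⟩
    | cons A Δ ih =>
      obtain ⟨hA, hΔ⟩ := Multiset.forall_mem_cons.1 h₂
      obtain ⟨t, ht, hAt⟩ := Set.mem_iUnion₂.1 hA
      obtain ⟨t', ht', hΔt'⟩ := ih hΔ
      rcases hchain.total ht ht' with h | h
      · exact ⟨t', ht', Multiset.forall_mem_cons.2 ⟨h.2 hAt, hΔt'⟩⟩
      · exact ⟨t, ht, Multiset.forall_mem_cons.2 ⟨hAt, fun B hB => h.2 (hΔt' B hB)⟩⟩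
  obtain ⟨t, ht, htΓ⟩ := hl
  obtain ⟨t', ht', htΔ⟩ := hr
  refine hU.1 _ (covers_cons.2 ⟨?_, hG⟩)
  rcases hchain.total ht ht' with h | h
  · exact ⟨t', hc ht', fun A hA => h.1 (htΓ A hA), htΔ⟩
  · exact ⟨t, hc ht, htΓ, fun A hA => h.2 (htΔ A hA)⟩

theorem exists_subset_cons {Γ : Multiset (Formula α)} {a : Set (Formula α)} {A : Formula α}
    (h : ∀ B ∈ Γ, B ∈ insert A a) : ∃ Γ', (∀ B ∈ Γ', B ∈ a) ∧ Γ ⊆ A ::ₘ Γ' := by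
  classical
  refine ⟨Γ.filter (· ≠ A), fun B hB => ?_, fun B hB => ?_⟩
  · obtain ⟨hB, hne⟩ := Multiset.mem_filter.1 hB
    exact (h B hB).resolve_left hne
  · by_cases hBA : B = A
    · simp [hBA]
    · exact Multiset.mem_cons_of_mem (Multiset.mem_filter.2 ⟨hB, hBA⟩)

/-- By maximality of `w`, adding `A` leaves `U`, and `mem_of_not_provable` yields the witnessing
proof. In the closure properties below, such proofs serve as premises of a rule whose conclusion is
covered by `U`, a contradiction. -/
theorem exists_provable_of_notMem_left (hU : Maximal Consistent U)
    (hw : Maximal (· ∈ U) w) {A : Formula α} (hA : A ∉ w.1) :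
    ∃ Γ Δ G, w.Covers (Γ ⟹ Δ) ∧ Covers U G ∧ Provable ((A ::ₘ Γ ⟹ Δ) ::ₘ G) := by
  by_contra! hcon
  refine hA ((hw.2 (y := (insert A w.1, w.2)) (mem_of_not_provable hU ?_)
    ⟨Set.subset_insert _ _, subset_rfl⟩).1 (Set.mem_insert _ _))
  intro Γ Δ G ⟨hΓ, hΔ⟩ hG hprov
  obtain ⟨Γ', hΓ', hsub⟩ := exists_subset_cons hΓ
  exact hcon Γ' Δ G ⟨hΓ', hΔ⟩ hG (hprov.monoL hsub)

theorem exists_provable_of_notMem_right (hU : Maximal Consistent U)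
    (hw : Maximal (· ∈ U) w) {A : Formula α} (hA : A ∉ w.2) :
    ∃ Γ Δ G, w.Covers (Γ ⟹ Δ) ∧ Covers U G ∧ Provable ((Γ ⟹ A ::ₘ Δ) ::ₘ G) := by
  by_contra! hcon
  refine hA ((hw.2 (y := (w.1, insert A w.2)) (mem_of_not_provable hU ?_)
    ⟨subset_rfl, Set.subset_insert _ _⟩).2 (Set.mem_insert _ _))
  intro Γ Δ G ⟨hΓ, hΔ⟩ hG hprov
  obtain ⟨Δ', hΔ', hsub⟩ := exists_subset_cons hΔ
  exact hcon Γ Δ' G ⟨hΓ, hΔ'⟩ hG (hprov.monoR hsub)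

theorem not_provable_of_covers (hU : Maximal Consistent U)
    (hw : Maximal (· ∈ U) w) {Γ Δ : Multiset (Formula α)} {G : Hypersequent α}
    (h : w.Covers (Γ ⟹ Δ)) (hG : Covers U G) : ¬ Provable ((Γ ⟹ Δ) ::ₘ G) :=
  hU.1 _ (covers_cons.2 ⟨⟨w, hw.1, h⟩, hG⟩)

theorem SetSequent.Covers.consL {Γ Δ : Multiset (Formula α)} {A : Formula α} (hA : A ∈ w.1)
    (h : w.Covers (Γ ⟹ Δ)) : w.Covers (A ::ₘ Γ ⟹ Δ) :=
  ⟨Multiset.forall_mem_cons.2 ⟨hA, h.1⟩, h.2⟩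

theorem SetSequent.Covers.consR {Γ Δ : Multiset (Formula α)} {A : Formula α} (hA : A ∈ w.2)
    (h : w.Covers (Γ ⟹ Δ)) : w.Covers (Γ ⟹ A ::ₘ Δ) :=
  ⟨h.1, Multiset.forall_mem_cons.2 ⟨hA, h.2⟩⟩

theorem SetSequent.Covers.add {Γ Γ' Δ Δ' : Multiset (Formula α)} (h : w.Covers (Γ ⟹ Δ))
    (h' : w.Covers (Γ' ⟹ Δ')) : w.Covers (Γ + Γ' ⟹ Δ + Δ') :=
  ⟨fun A hA => (Multiset.mem_add.1 hA).elim (h.1 A) (h'.1 A),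
    fun A hA => (Multiset.mem_add.1 hA).elim (h.2 A) (h'.2 A)⟩

theorem SetSequent.covers_zero (w : SetSequent α) : w.Covers (0 ⟹ 0) := by
  simp [SetSequent.Covers]

theorem var_notMem_right (hU : Maximal Consistent U)
    (hw : Maximal (· ∈ U) w) {p : α} (h : var p ∈ w.1) : var p ∉ w.2 := fun h' =>
  not_provable_of_covers hU hw ((w.covers_zero.consL h).consR h') (G := 0) (by simp [Covers])
    (.ax p 0 0 0)

theorem mem_right_of_neg_mem_left (hU : Maximal Consistent U)
    (hw : Maximal (· ∈ U) w) {A : Formula α} (h : neg A ∈ w.1) : A ∈ w.2 := by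
  by_contra hA
  obtain ⟨Γ, Δ, G, hc, hG, hp⟩ := exists_provable_of_notMem_right hU hw hA
  exact not_provable_of_covers hU hw (hc.consL h) hG hp.negL

theorem mem_left_of_neg_mem_right (hU : Maximal Consistent U)
    (hw : Maximal (· ∈ U) w) {A : Formula α} (h : neg A ∈ w.2) : A ∈ w.1 := by
  by_contra hA
  obtain ⟨Γ, Δ, G, hc, hG, hp⟩ := exists_provable_of_notMem_left hU hw hA
  exact not_provable_of_covers hU hw (hc.consR h) hG hp.negR

theorem mem_or_mem_of_imp_mem_left (hU : Maximal Consistent U)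
    (hw : Maximal (· ∈ U) w) {A B : Formula α} (h : imp A B ∈ w.1) :
    A ∈ w.2 ∨ B ∈ w.1 := by
  by_contra! hcon
  obtain ⟨Γ, Δ, G, hc, hG, hp⟩ := exists_provable_of_notMem_right hU hw hcon.1
  obtain ⟨Γ', Δ', G', hc', hG', hp'⟩ := exists_provable_of_notMem_left hU hw hcon.2
  -- The two premises come with unrelated contexts; both are weakened to the sum.
  refine not_provable_of_covers hU hw ((hc.add hc').consL h) (hG.add hG') (Provable.impL ?_ ?_)
  · refine hp.mono_cons ?_ ?_ (Multiset.le_add_right _ _)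
    · exact fun X hX => by simp [hX]
    · exact Multiset.cons_subset_cons fun X hX => by simp [hX]
  · refine hp'.mono_cons ?_ ?_ (Multiset.le_add_left _ _)
    · exact Multiset.cons_subset_cons fun X hX => by simp [hX]
    · exact fun X hX => by simp [hX]

theorem mem_left_of_imp_mem_right (hU : Maximal Consistent U)
    (hw : Maximal (· ∈ U) w) {A B : Formula α} (h : imp A B ∈ w.2) : A ∈ w.1 := by
  by_contra hA
  obtain ⟨Γ, Δ, G, hc, hG, hp⟩ := exists_provable_of_notMem_left hU hw hA
  exact not_provable_of_covers hU hw (hc.consR h) hG hp.weakR.impR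

theorem mem_right_of_imp_mem_right (hU : Maximal Consistent U)
    (hw : Maximal (· ∈ U) w) {A B : Formula α} (h : imp A B ∈ w.2) : B ∈ w.2 := by
  by_contra hB
  obtain ⟨Γ, Δ, G, hc, hG, hp⟩ := exists_provable_of_notMem_right hU hw hB
  exact not_provable_of_covers hU hw (hc.consR h) hG hp.weakL.impR

/-- The rule `s5` links different worlds: the component `box A ⟹` covered by `w` is moved into a
component covered by `v`, where `boxL` applies. -/
theorem mem_left_of_box_mem_left (hU : Maximal Consistent U)
    (hw : Maximal (· ∈ U) w) {A : Formula α} (h : box A ∈ w.1) {v : SetSequent α}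
    (hv : Maximal (· ∈ U) v) : A ∈ v.1 := by
  by_contra hA
  obtain ⟨Γ, Δ, G, hc, hG, hp⟩ := exists_provable_of_notMem_left hU hv hA
  refine not_provable_of_covers hU hw (w.covers_zero.consL h)
    (covers_cons.2 ⟨⟨v, hv.1, hc⟩, hG⟩) (Provable.s5 ?_)
  have : Provable ((box A ::ₘ Γ ⟹ Δ) ::ₘ G) :=
    Provable.boxL (hp.monoL (Multiset.cons_subset_cons (Multiset.subset_cons _ _)))
  refine this.monoL (Multiset.cons_subset.2 ⟨?_, fun X hX => by simp [hX]⟩)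
  exact Multiset.mem_add.2 (Or.inl (Multiset.mem_add.2 (Or.inl
    (Multiset.mem_filter.2 ⟨Multiset.mem_cons_self _ _, rfl⟩))))

/-- The new world is grown from the pair with only `A` on the right. The boxed formulas and
obligations of `w` need not be copied, since `s5` already makes them act on all worlds. -/
theorem exists_mem_right_of_box_mem_right (hU : Maximal Consistent U)
    (hw : Maximal (· ∈ U) w) {A : Formula α} (h : box A ∈ w.2) :
    ∃ v, Maximal (· ∈ U) v ∧ A ∈ v.2 := by
  have hmem : ((∅, {A}) : SetSequent α) ∈ U := by
    refine mem_of_not_provable hU fun Γ Δ G ⟨hΓ, hΔ⟩ hG hp => ?_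
    refine not_provable_of_covers hU hw (w.covers_zero.consR h) hG (Provable.boxR ?_)
    refine hp.mono_cons (fun X hX => (hΓ X hX).elim) (fun X hX => ?_) le_rfl
    exact Multiset.mem_singleton.2 (hΔ X hX)
  obtain ⟨v, hle, hv⟩ := exists_maximal_ge hU hmem
  exact ⟨v, hv, hle.2 rfl⟩

theorem mem_of_obl_mem_left (hU : Maximal Consistent U)
    (hw : Maximal (· ∈ U) w) {A B : Formula α} (h : obl B A ∈ w.1) {v : SetSequent α}
    (hv : Maximal (· ∈ U) v) : A ∈ v.2 ∨ bet (neg A) ∈ v.2 ∨ B ∈ v.1 := by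
  by_contra! hcon
  obtain ⟨Γ₁, Δ₁, G₁, hc₁, hG₁, hp₁⟩ := exists_provable_of_notMem_right hU hv hcon.1
  obtain ⟨Γ₂, Δ₂, G₂, hc₂, hG₂, hp₂⟩ := exists_provable_of_notMem_right hU hv hcon.2.1
  obtain ⟨Γ₃, Δ₃, G₃, hc₃, hG₃, hp₃⟩ := exists_provable_of_notMem_left hU hv hcon.2.2
  refine not_provable_of_covers hU hw (w.covers_zero.consL h)
    (covers_cons.2 ⟨⟨v, hv.1, (hc₁.add hc₂).add hc₃⟩, (hG₁.add hG₂).add hG₃⟩) (Provable.s5 ?_)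
  have : Provable ((obl B A ::ₘ (Γ₁ + Γ₂ + Γ₃) ⟹ Δ₁ + Δ₂ + Δ₃) ::ₘ (G₁ + G₂ + G₃)) := by
    refine Provable.oblL ?_ ?_ ?_
    · refine hp₁.mono_cons (fun X hX => by simp [hX])
        (Multiset.cons_subset_cons fun X hX => by simp [hX]) ?_
      rw [add_assoc]
      exact Multiset.le_add_right _ _
    · refine hp₂.mono_cons (fun X hX => by simp [hX])
        (Multiset.cons_subset_cons fun X hX => by simp [hX]) ?_
      exact (Multiset.le_add_left _ _).trans (Multiset.le_add_right _ _)
    · exact hp₃.mono_cons (Multiset.cons_subset_cons fun X hX => by simp [hX])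
        (fun X hX => by simp [hX]) (Multiset.le_add_left _ _)
  refine this.monoL (Multiset.cons_subset.2 ⟨?_, fun X hX => Multiset.mem_add.2 (Or.inr hX)⟩)
  exact Multiset.mem_add.2 (Or.inl (Multiset.mem_add.2 (Or.inr
    (Multiset.mem_filter.2 ⟨Multiset.mem_cons_self _ _, rfl⟩))))

theorem exists_of_obl_mem_right (hU : Maximal Consistent U)
    (hw : Maximal (· ∈ U) w) {A B : Formula α} (h : obl B A ∈ w.2) :
    ∃ v, Maximal (· ∈ U) v ∧ A ∈ v.1 ∧ bet (neg A) ∈ v.1 ∧ B ∈ v.2 := by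
  -- Placing `bet (neg A)` on the left beside `A` is what makes the new world a best `A`-world.
  have hmem : (({A, bet (neg A)}, {B}) : SetSequent α) ∈ U := by
    refine mem_of_not_provable hU fun Γ Δ G ⟨hΓ, hΔ⟩ hG hp => ?_
    refine not_provable_of_covers hU hw (w.covers_zero.consR h) hG (Provable.oblR ?_)
    refine hp.mono_cons (fun X hX => ?_) (fun X hX => ?_) le_rfl
    · rcases hΓ X hX with rfl | rfl <;> simp
    · exact Multiset.mem_singleton.2 (hΔ X hX)
  obtain ⟨v, hle, hv⟩ := exists_maximal_ge hU hmem
  exact ⟨v, hv, hle.1 (by simp), hle.1 (by simp), hle.2 rfl⟩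

theorem exists_of_bet_mem_right (hU : Maximal Consistent U)
    (hw : Maximal (· ∈ U) w) {A : Formula α} (h : bet A ∈ w.2) :
    ∃ v, Maximal (· ∈ U) v ∧ (∀ B, bet B ∈ w.1 → B ∈ v.1) ∧ A ∈ v.2 := by
  have hmem : (({B | bet B ∈ w.1}, {A}) : SetSequent α) ∈ U := by
    refine mem_of_not_provable hU fun Γ Δ G ⟨hΓ, hΔ⟩ hG hp => ?_
    -- Prefixing `bet` turns `Γ` into an antecedent covered by `w` whose `betPart` gives `Γ` back.
    have hc : w.Covers (Γ.map bet ⟹ 0) := by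
      refine ⟨fun X hX => ?_, by simp⟩
      obtain ⟨B, hB, rfl⟩ := Multiset.mem_map.1 hX
      exact hΓ B hB
    refine not_provable_of_covers hU hw (hc.consR h) hG (Provable.betR ?_)
    refine hp.mono_cons (fun X hX => ?_) (fun X hX => ?_) le_rfl
    · exact Multiset.mem_add.2 (Or.inr (mem_betPart.2 (Multiset.mem_map_of_mem bet hX)))
    · exact Multiset.mem_singleton.2 (hΔ X hX)
  obtain ⟨v, hle, hv⟩ := exists_maximal_ge hU hmem
  exact ⟨v, hv, fun B hB => hle.1 hB, hle.2 rfl⟩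

end Saturation

/-- The model whose worlds are the maximal members of `U`. -/
def canonicalModel (U : Set (SetSequent α)) : Model α where
  World := {w : SetSequent α // Maximal (· ∈ U) w}
  better w v := ∀ A, bet A ∈ w.1.1 → A ∈ v.1.1
  val w p := var p ∈ w.1.1

theorem canonicalModel_sat {U : Set (SetSequent α)} (hU : Maximal Consistent U) (A : Formula α)
    (w : (canonicalModel U).World) :
    (A ∈ w.1.1 → (canonicalModel U).Sat w A) ∧ (A ∈ w.1.2 → ¬ (canonicalModel U).Sat w A) := by
  induction A generalizing w with
  | var p => exact ⟨id, fun h h' => var_notMem_right hU w.2 h' h⟩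
  | neg A ih =>
    exact ⟨fun h => (ih w).2 (mem_right_of_neg_mem_left hU w.2 h),
      fun h h' => h' ((ih w).1 (mem_left_of_neg_mem_right hU w.2 h))⟩
  | imp A B ihA ihB =>
    refine ⟨fun h hA => ?_, fun h h' => ?_⟩
    · rcases mem_or_mem_of_imp_mem_left hU w.2 h with h | h
      · exact ((ihA w).2 h hA).elim
      · exact (ihB w).1 h
    · exact (ihB w).2 (mem_right_of_imp_mem_right hU w.2 h)
        (h' ((ihA w).1 (mem_left_of_imp_mem_right hU w.2 h)))
  | box A ih =>
    refine ⟨fun h v => (ih v).1 (mem_left_of_box_mem_left hU w.2 h v.2), fun h h' => ?_⟩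
    obtain ⟨v, hv, hA⟩ := exists_mem_right_of_box_mem_right hU w.2 h
    exact (ih ⟨v, hv⟩).2 hA (h' ⟨v, hv⟩)
  | obl B A ihB ihA =>
    refine ⟨fun h v hA hbest => ?_, fun h h' => ?_⟩
    · rcases mem_of_obl_mem_left hU w.2 h v.2 with h | h | h
      · exact ((ihA v).2 h hA).elim
      -- A right occurrence of `bet (neg A)` yields a better world `u` with `neg A` on the right,
      -- hence `A` on the left, so `v` is not a best `A`-world.
      · obtain ⟨u, hu, hvu, hn⟩ := exists_of_bet_mem_right hU v.2 h
        exact (hbest ⟨u, hu⟩ hvu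
          ((ihA ⟨u, hu⟩).1 (mem_left_of_neg_mem_right hU hu hn))).elim
      · exact (ihB v).1 h
    · obtain ⟨v, hv, hA, hb, hB⟩ := exists_of_obl_mem_right hU w.2 h
      refine (ihB ⟨v, hv⟩).2 hB (h' ⟨v, hv⟩ ((ihA ⟨v, hv⟩).1 hA) fun u hu => ?_)
      exact (ihA u).2 (mem_right_of_neg_mem_left hU u.2 (hu _ hb))
  | bet A ih =>
    refine ⟨fun h v hv => (ih v).1 (hv A h), fun h h' => ?_⟩
    obtain ⟨v, hv, hwv, hA⟩ := exists_of_bet_mem_right hU w.2 h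
    exact (ih ⟨v, hv⟩).2 hA (h' ⟨v, hv⟩ hwv)

/-- Completeness of the cut-free calculus. -/
theorem provable_of_forall_valid {H : Hypersequent α} (h : ∀ M : Model α, M.Valid H) :
    Provable H := by
  by_contra hH
  -- Start from the components of `H` as pairs of sets; anything they cover proves `H` by `mono`.
  have hcons : Consistent {s : SetSequent α | ∃ S ∈ H, s = ({A | A ∈ S.ant}, {A | A ∈ S.suc})} := by
    refine fun G hG hp => hH (hp.mono fun S hS => ?_)
    obtain ⟨s, ⟨T, hT, rfl⟩, hc⟩ := hG S hS
    exact ⟨T, hT, fun A hA => hc.1 A hA, fun A hA => hc.2 A hA⟩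
  obtain ⟨U, hHU, hU⟩ := exists_maximal_consistent hcons
  obtain ⟨S, hS, hvalid⟩ := h (canonicalModel U)
  -- A maximal member above the supposedly valid component `S` makes its antecedent true and its
  -- succedent false.
  obtain ⟨w, hle, hw⟩ := exists_maximal_ge hU (hHU ⟨S, hS, rfl⟩)
  obtain ⟨A, hA, hsat⟩ := hvalid ⟨w, hw⟩ fun A hA => (canonicalModel_sat hU A ⟨w, hw⟩).1 (hle.1 hA)
  exact (canonicalModel_sat hU A ⟨w, hw⟩).2 (hle.2 hA) hsat

end HE

theorem mainTheorem1 {α : Type u} :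
    (∀ (H : HE.Hypersequent α) (_ : HE.Proof H), ∃ d : HE.Proof H, d.CutFree) ∧
    (∀ (H : HE.Hypersequent α) (d : HE.Proof H), d.CutFree →
      ∀ B : HE.Formula α, d.Occurs B →
        ∃ A : HE.Formula α, H.Contains A ∧ B.IsRelaxedSubformula A) :=
  ⟨fun _ d => HE.provable_of_forall_valid fun M => d.sound M,
    fun _ d hd => HE.Proof.CutFree.isRelaxedSubformula_of_occurs d hd⟩
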